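/- Write $\mathbb{D}$ for the open unit disc and $\mathbb{T}$ for the unit circle. Let $\Theta$ be an inner function, that is, a bounded analytic function on $\mathbb{D}$ whose radial boundary values have modulus $1$ almost everywhere on $\mathbb{T}$. Let $\Theta = BS$ on $\mathbb{D}$, where $B$ is a (finite or infinite) Blaschke product $$B(z)=\lambda z^p\prod_j \frac{|a_j|}{a_j}\,\frac{a_j-z}{1-\overline{a_j}z},\qquad |\lambda|=1,\ p\in\mathbb{Z}_{\ge 0},\ a_j\in\mathbb{D}\setminus\{0\},\ \sum_j(1-|a_j|)<\infty,$$ and $S$ is a singular inner function $$S(z)=\exp\left(-\int_{\mathbb{T}}\frac{\zeta+z}{\zeta-z}\,d\mu(\zeta)\right),$$ with $\mu$ a finite positive Borel measure on $\mathbb{T}$ that is singular with respect to Lebesgue measure (here $B$ may be constant and $\mu$ may be $0$). A point of $\mathbb{T}$ is called a singularity of $\Theta$ if $\Theta$ has no analytic extension into a neighbourhood of it. Assume that $\Theta$ has only finitely many singularities. Let $\theta_0\in\mathbb{R}$, and suppose that at least one of the following holds: 1. there are $\alpha>1$ and a sequence $(z_n)$ of zeros of $\Theta$ in the Stolz angle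 $\{z\in\mathbb{D}: |e^{i\theta_0}-z|<\alpha(1-|z|)\}$ such that $z_n\to e^{i\theta_0}$; 2. $e^{i\theta_0}\in\operatorname{supp}(\mu)$. Then $e^{i\theta_0}$ is a singularity of $\Theta$ of type $2$. That is, $e^{i\theta_0}$ is a singularity of $\Theta$ and, for every $\varepsilon>0$, the equation $\Theta(\xi)=1$, understood in the sense of radial boundary values, has infinitely many solutions $\xi$ in each of the open arcs $(e^{i(\theta_0-\varepsilon)},e^{i\theta_0})$ and $(e^{i\theta_0},e^{i(\theta_0+\varepsilon)})$ of $\mathbb{T}$. -/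

import Mathlib

open Set Filter Topology MeasureTheory

noncomputable section

namespace InnerFunction

/-- The circle carries its Borel sigma-algebra. -/
instance : MeasurableSpace Circle := borel Circle

instance : BorelSpace Circle := ⟨rfl⟩

/-- The open unit disc `𝔻`, as a set of complex numbers. -/
def disc : Set ℂ := Metric.ball 0 1

/-- Arc length (Lebesgue) measure on the unit circle. -/
def arcLength : Measure Circle :=
  (volume.restrict (Ioc 0 (2 * Real.pi))).map Circle.exp

/-- `f` has the boundary value `w` at the point `ξ` of the unit circle: the radial limit of `f`
at `ξ` exists and equals `w`. Where `f` extends analytically across `ξ`, this means that the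
extension takes the value `w` at `ξ`. -/
def HasBoundaryValue (f : ℂ → ℂ) (ξ : Circle) (w : ℂ) : Prop :=
  Tendsto (fun r : ℝ => f ((r : ℂ) * (ξ : ℂ))) (𝓝[<] 1) (𝓝 w)

/-- Inner functions: bounded and analytic in the disc, with boundary values of modulus one at
almost every point of the circle. Only the values of the function in the disc matter. -/
structure IsInner (f : ℂ → ℂ) : Prop where
  analytic : AnalyticOnNhd ℂ f disc
  bounded : ∃ M : ℝ, ∀ z ∈ disc, ‖f z‖ ≤ M
  unimodular : ∀ᵐ ξ ∂arcLength, ∃ w : ℂ, ‖w‖ = 1 ∧ HasBoundaryValue f ξ w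

/-- The elementary factor `(|a| / a) (a - z) / (1 - conj a * z)`, for `a ≠ 0`. -/
def blaschkeFactor (a z : ℂ) : ℂ :=
  (‖a‖ : ℂ) / a * ((a - z) / (1 - (starRingEnd ℂ) a * z))

/-- `B` is in the disc a finite or infinite Blaschke product
`c z ^ p ∏ⱼ (|aⱼ| / aⱼ) (aⱼ - z) / (1 - conj aⱼ * z)`; the zeros other than the origin are
indexed, with multiplicity, by a set `J` of natural numbers, which may be finite or empty. -/
def IsBlaschkeProduct (B : ℂ → ℂ) : Prop :=
  ∃ (c : ℂ) (p : ℕ) (J : Set ℕ) (a : J → ℂ),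
    ‖c‖ = 1 ∧ (∀ j, a j ≠ 0 ∧ a j ∈ disc) ∧ Summable (fun j => 1 - ‖a j‖) ∧
      ∀ z ∈ disc, ∃ P : ℂ, HasProd (fun j => blaschkeFactor (a j) z) P ∧ B z = c * z ^ p * P

/-- `S` is in the disc the singular inner function with singular measure `μ`, where `μ` is a
finite positive measure on the circle that is singular to arc length (possibly `μ = 0`). -/
structure IsSingularInner (S : ℂ → ℂ) (μ : Measure Circle) : Prop where
  finite : IsFiniteMeasure μ
  singular : μ.MutuallySingular arcLength
  eq_exp : ∀ z ∈ disc, S z = Complex.exp (-∫ ζ : Circle, ((ζ : ℂ) + z) / ((ζ : ℂ) - z) ∂μ)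

/-- The spectrum `σ(f)`, that is, the set of singularities of `f`: the points of the unit circle
into no neighbourhood of which `f` extends analytically. -/
def singularities (f : ℂ → ℂ) : Set Circle :=
  {ξ | ¬ ∃ g : ℂ → ℂ, AnalyticAt ℂ g (ξ : ℂ) ∧ ∀ᶠ z in 𝓝[disc] (ξ : ℂ), g z = f z}

/-- The Stolz angle `Γ_α` at the point `ξ` of the circle. -/
def stolzAngle (ξ : Circle) (α : ℝ) : Set ℂ :=
  {z | z ∈ disc ∧ ‖(ξ : ℂ) - z‖ < α * (1 - ‖z‖)}

/-- The point `exp (i θ)` is a singularity of type 2 of `f`: for every `ε > 0` (equivalently, for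
all sufficiently small `ε > 0`) the equation `f = 1` has infinitely many solutions on each of the
arcs `(exp (i (θ - ε)), exp (i θ))` and `(exp (i θ), exp (i (θ + ε)))` of the circle. -/
def IsTypeTwo (f : ℂ → ℂ) (θ : ℝ) : Prop :=
  Circle.exp θ ∈ singularities f ∧
    ∀ ε : ℝ, 0 < ε →
      {ξ : Circle | ξ ∈ Circle.exp '' Ioo (θ - ε) θ ∧ HasBoundaryValue f ξ 1}.Infinite ∧
      {ξ : Circle | ξ ∈ Circle.exp '' Ioo θ (θ + ε) ∧ HasBoundaryValue f ξ 1}.Infinite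

end InnerFunction

end

open Set Filter Topology MeasureTheory

noncomputable section

namespace InnerFunction

/-! On an arc free of singularities `Θ` extends analytically with modulus one, so `Θ(e^{it}) =
e^{iψ(t)}`. The tangential derivative `ψ'` equals the radial derivative of `|Θ|` at the circle, so
`2ψ'` is the limit of `(1 - |Θ|²) / (1 - r)` along the radius (`exists_phase_deriv`). Hence `ψ' ≥
0`, and any upper bound for `|Θ|` in the disc gives a lower bound for `ψ'`.

A zero `a` in the Stolz angle, with `h = 1 - |a|`, gives by Schwarz-Pick `ψ' ≥ c / h` at angular
distance between `h / 2` and `h` from `θ₀`, on both sides. If `e^{iθ₀}` lies in the support of `μ`,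
it is an atom, since `μ` does not charge regular points and the singularities are finite in number;
the factor of the atom gives a bound of the same kind (`HasSteepPhase`).

Each such `h` adds at least `c / 2` to the phase, and `h` may be arbitrarily small, so on each side
the monotone phase is unbounded near `θ₀` and passes through the multiples of `2π` infinitely often.
-/

theorem norm_circle_exp_sub_le (x y : ℝ) :
    ‖(Circle.exp x : ℂ) - Circle.exp y‖ ≤ |x - y| := by
  have h : (Circle.exp x : ℂ) - Circle.exp y
      = Circle.exp y * (Complex.exp (Complex.I * ((x - y : ℝ) : ℂ)) - 1) := by
    rw [Circle.coe_exp, Circle.coe_exp, mul_sub, ← Complex.exp_add, mul_one]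
    congr 2
    push_cast
    ring
  rw [h, norm_mul, Circle.norm_coe, one_mul]
  exact Real.norm_exp_I_mul_ofReal_sub_one_le

theorem circle_dist_eq (ξ η : Circle) : dist ξ η = ‖(ξ : ℂ) - η‖ := dist_eq_norm (ξ : ℂ) η

theorem mem_disc {z : ℂ} : z ∈ disc ↔ ‖z‖ < 1 := by simp [disc]

theorem ofReal_mul_circle_mem_disc {r : ℝ} (ξ : Circle) (hr : r ∈ Ioo (0 : ℝ) 1) :
    (r : ℂ) * ξ ∈ disc := by
  rw [mem_disc, norm_mul, Circle.norm_coe, mul_one, Complex.norm_real, Real.norm_of_nonneg hr.1.le]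
  exact hr.2

/-! ### Disc automorphisms and the Schwarz-Pick lemma. -/

theorem one_sub_conj_mul_ne_zero {a z : ℂ} (ha : ‖a‖ < 1) (hz : ‖z‖ ≤ 1) :
    1 - (starRingEnd ℂ) a * z ≠ 0 := by
  intro h
  have h1 : ‖(starRingEnd ℂ) a * z‖ = 1 := by rw [← sub_eq_zero.1 h, norm_one]
  rw [norm_mul, RCLike.norm_conj] at h1
  nlinarith [norm_nonneg a, norm_nonneg z]

theorem norm_sq_one_sub_conj_mul_sub (a z : ℂ) :
    ‖1 - (starRingEnd ℂ) a * z‖ ^ 2 - ‖a - z‖ ^ 2 = (1 - ‖a‖ ^ 2) * (1 - ‖z‖ ^ 2) := by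
  simp only [← Complex.normSq_eq_norm_sq, Complex.normSq_apply, Complex.sub_re, Complex.sub_im,
    Complex.mul_re, Complex.mul_im, Complex.conj_re, Complex.conj_im, Complex.one_re,
    Complex.one_im]
  ring

/-- The involutive automorphism of the disc that exchanges `a` and `0`. -/
def mobius (a z : ℂ) : ℂ := (a - z) / (1 - (starRingEnd ℂ) a * z)

/-- The factor `1 - ‖z‖ ^ 2` is explicit, so dividing by `1 - r` on the radius `z = rζ` leaves an
expression with a limit at the circle. -/
theorem one_sub_norm_mobius_sq {a z : ℂ} (ha : ‖a‖ < 1) (hz : ‖z‖ ≤ 1) :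
    1 - ‖mobius a z‖ ^ 2
      = (1 - ‖a‖ ^ 2) * (1 - ‖z‖ ^ 2) / ‖1 - (starRingEnd ℂ) a * z‖ ^ 2 := by
  have h := norm_ne_zero_iff.2 (one_sub_conj_mul_ne_zero ha hz)
  rw [mobius, norm_div, ← norm_sq_one_sub_conj_mul_sub, div_pow, sub_div, div_self (pow_ne_zero 2 h)]

theorem norm_mobius_lt_one {a z : ℂ} (ha : ‖a‖ < 1) (hz : ‖z‖ < 1) : ‖mobius a z‖ < 1 := by
  have h := norm_pos_iff.2 (one_sub_conj_mul_ne_zero ha hz.le)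
  have h1 : 0 < 1 - ‖mobius a z‖ ^ 2 := by
    rw [one_sub_norm_mobius_sq ha hz.le]
    have := norm_nonneg a
    have := norm_nonneg z
    have h2 : 0 < 1 - ‖a‖ ^ 2 := by nlinarith
    have h3 : 0 < 1 - ‖z‖ ^ 2 := by nlinarith
    positivity
  nlinarith [norm_nonneg (mobius a z)]

theorem mobius_mobius {a z : ℂ} (ha : ‖a‖ < 1) (hz : ‖z‖ < 1) : mobius a (mobius a z) = z := by
  have h1 := one_sub_conj_mul_ne_zero ha hz.le
  have h2 := one_sub_conj_mul_ne_zero ha ha.le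
  have h3 := one_sub_conj_mul_ne_zero ha (norm_mobius_lt_one ha hz).le
  have h4 : mobius a z * (1 - (starRingEnd ℂ) a * z) = a - z := div_mul_cancel₀ _ h1
  rw [mobius, div_eq_iff h3]
  refine mul_right_cancel₀ h1 ?_
  linear_combination ((starRingEnd ℂ) a * z - 1) * h4

/-- The **Schwarz-Pick lemma** at a zero. -/
theorem norm_le_norm_mobius {f : ℂ → ℂ} (hf : DifferentiableOn ℂ f disc)
    (hb : ∀ z ∈ disc, ‖f z‖ ≤ 1) {a z : ℂ} (ha : a ∈ disc) (hfa : f a = 0) (hz : z ∈ disc) :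
    ‖f z‖ ≤ ‖mobius a z‖ := by
  rw [mem_disc] at ha hz
  have hm : MapsTo (mobius a) disc disc := fun w hw => by
    rw [mem_disc] at hw ⊢
    exact norm_mobius_lt_one ha hw
  have hd : DifferentiableOn ℂ (mobius a) disc := by
    intro w hw
    have := one_sub_conj_mul_ne_zero ha (mem_disc.1 hw).le
    unfold mobius
    fun_prop (disch := assumption)
  -- The Schwarz lemma applies to `f ∘ mobius a`, which vanishes at `0`; evaluating at `mobius a z`
  -- recovers `f z`, as `mobius a` is an involution.
  have h := Complex.norm_le_norm_of_mapsTo_ball (f := f ∘ mobius a) (R := 1)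
    (z := mobius a z) (hf.comp hd hm)
    (fun w hw => by simpa using hb _ (hm hw)) (by simp [mobius, hfa]) (norm_mobius_lt_one ha hz)
  simpa [mobius_mobius ha hz] using h

/-! ### Bounds for the Blaschke and singular factors. -/

theorem norm_blaschkeFactor_le_one {a z : ℂ} (ha : a ∈ disc) (hz : z ∈ disc) :
    ‖blaschkeFactor a z‖ ≤ 1 := by
  have h1 : ‖(‖a‖ : ℂ) / a‖ ≤ 1 := by
    rw [norm_div, Complex.norm_real, norm_norm]
    exact div_self_le_one _
  rw [blaschkeFactor, norm_mul]
  exact mul_le_one₀ h1 (norm_nonneg _) (norm_mobius_lt_one (mem_disc.1 ha) (mem_disc.1 hz)).le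

theorem IsBlaschkeProduct.norm_le_one {B : ℂ → ℂ} (hB : IsBlaschkeProduct B) {z : ℂ}
    (hz : z ∈ disc) : ‖B z‖ ≤ 1 := by
  obtain ⟨c, p, J, a, hc, ha, -, h⟩ := hB
  obtain ⟨P, hP, hBz⟩ := h z hz
  have hP1 : ‖P‖ ≤ 1 := by
    refine le_of_tendsto hP.norm (Eventually.of_forall fun s => ?_)
    exact Finset.prod_le_one (fun _ _ => norm_nonneg _)
      fun j _ => norm_blaschkeFactor_le_one (ha j).2 hz
  rw [hBz, norm_mul, norm_mul, norm_pow, hc, one_mul]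
  exact mul_le_one₀ (pow_le_one₀ (norm_nonneg _) (mem_disc.1 hz).le) (norm_nonneg _) hP1

theorem circle_sub_ne_zero (ζ : Circle) {z : ℂ} (hz : z ∈ disc) : (ζ : ℂ) - z ≠ 0 := by
  intro h
  have := mem_disc.1 hz
  rw [← sub_eq_zero.1 h, Circle.norm_coe] at this
  exact lt_irrefl _ this

theorem herglotz_re (ζ : Circle) (z : ℂ) :
    (((ζ : ℂ) + z) / ((ζ : ℂ) - z)).re = (1 - ‖z‖ ^ 2) / ‖(ζ : ℂ) - z‖ ^ 2 := by
  have h : Complex.normSq (ζ : ℂ) = 1 := Circle.normSq_coe ζ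
  rw [Complex.div_re, ← add_div, Complex.normSq_eq_norm_sq]
  congr 1
  rw [← Complex.normSq_eq_norm_sq, Complex.normSq_apply, ← h, Complex.normSq_apply]
  simp only [Complex.add_re, Complex.sub_re, Complex.add_im, Complex.sub_im]
  ring

theorem herglotz_re_nonneg (ζ : Circle) {z : ℂ} (hz : z ∈ disc) :
    0 ≤ (((ζ : ℂ) + z) / ((ζ : ℂ) - z)).re := by
  rw [herglotz_re ζ z]
  have := mem_disc.1 hz
  have := norm_nonneg z
  have : 0 ≤ 1 - ‖z‖ ^ 2 := by nlinarith
  positivity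

theorem integrable_herglotz (μ : Measure Circle) [IsFiniteMeasure μ] {z : ℂ} (hz : z ∈ disc) :
    Integrable (fun ζ : Circle => ((ζ : ℂ) + z) / ((ζ : ℂ) - z)) μ := by
  have hc : Continuous fun ζ : Circle => ((ζ : ℂ) + z) / ((ζ : ℂ) - z) :=
    (by fun_prop : Continuous fun ζ : Circle => (ζ : ℂ) + z).div (by fun_prop)
      fun ζ => circle_sub_ne_zero ζ hz
  exact hc.integrable_of_hasCompactSupport (HasCompactSupport.of_compactSpace _)

/-- Since `-log |S|` is the integral of the nonnegative Poisson kernel, it can only decrease when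
the integral is restricted to `A`. It is applied to the empty set, to small balls and to a single
atom. -/
theorem IsSingularInner.norm_le_exp {S : ℂ → ℂ} {μ : Measure Circle} (hS : IsSingularInner S μ)
    {z : ℂ} (hz : z ∈ disc) {A : Set Circle} (hA : MeasurableSet A) {c : ℝ}
    (hc : ∀ ζ ∈ A, c ≤ (((ζ : ℂ) + z) / ((ζ : ℂ) - z)).re) :
    ‖S z‖ ≤ Real.exp (-(c * μ.real A)) := by
  have := hS.finite
  have hi := integrable_herglotz μ hz
  rw [hS.eq_exp z hz, Complex.norm_exp, Real.exp_le_exp, Complex.neg_re, neg_le_neg_iff]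
  have h1 : (∫ ζ : Circle, ((ζ : ℂ) + z) / ((ζ : ℂ) - z) ∂μ).re
      = ∫ ζ : Circle, (((ζ : ℂ) + z) / ((ζ : ℂ) - z)).re ∂μ := (integral_re hi).symm
  rw [h1]
  calc c * μ.real A = ∫ _ in A, c ∂μ := by
        rw [setIntegral_const, smul_eq_mul, mul_comm]
    _ ≤ ∫ ζ in A, (((ζ : ℂ) + z) / ((ζ : ℂ) - z)).re ∂μ :=
        setIntegral_mono_on (integrable_const _).integrableOn hi.re.integrableOn hA hc
    _ ≤ _ := setIntegral_le_integral hi.re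
        (Eventually.of_forall fun ζ => herglotz_re_nonneg ζ hz)

theorem IsSingularInner.norm_le_one {S : ℂ → ℂ} {μ : Measure Circle} (hS : IsSingularInner S μ)
    {z : ℂ} (hz : z ∈ disc) : ‖S z‖ ≤ 1 := by
  simpa using hS.norm_le_exp hz (A := ∅) MeasurableSet.empty (c := 0) (by simp)

/-! ### Boundary values and phase at regular points. -/

theorem arcLength_pos {W : Set Circle} (hW : IsOpen W) (hne : W.Nonempty) : 0 < arcLength W := by
  obtain ⟨ξ, hξ⟩ := hne
  obtain ⟨t, ht, rfl⟩ : ∃ t ∈ Ioc (0 : ℝ) (0 + 2 * Real.pi), Circle.exp t = ξ := by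
    obtain ⟨t, ht, h⟩ := Circle.periodic_exp.exists_mem_Ioc Real.two_pi_pos (Complex.arg ξ) 0
    exact ⟨t, ht, by rw [← h, Circle.exp_arg]⟩
  rw [zero_add] at ht
  have hm : Measurable Circle.exp := Circle.exp.continuous.measurable
  rw [arcLength, Measure.map_apply hm hW.measurableSet,
    Measure.restrict_apply (hm hW.measurableSet)]
  -- The neighbourhood is one-sided because `t` may be the right endpoint `2π`.
  obtain ⟨l, hl, hlt⟩ := exists_Ioc_subset_of_mem_nhds
    ((hW.preimage Circle.exp.continuous).mem_nhds hξ) ⟨0, ht.1⟩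
  have h : Ioc (max l 0) t ⊆ Circle.exp ⁻¹' W ∩ Ioc 0 (2 * Real.pi) := fun x hx =>
    ⟨hlt ⟨(le_max_left _ _).trans_lt hx.1, hx.2⟩, (le_max_right _ _).trans_lt hx.1,
      hx.2.trans ht.2⟩
  refine lt_of_lt_of_le ?_ (measure_mono h)
  rw [Real.volume_Ioc, ENNReal.ofReal_pos, sub_pos]
  exact max_lt hl ht.1

theorem tendsto_ofReal_mul_circle (η : Circle) :
    Tendsto (fun r : ℝ => (r : ℂ) * (η : ℂ)) (𝓝[<] 1) (𝓝 (η : ℂ)) := by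
  have h : Continuous fun r : ℝ => (r : ℂ) * (η : ℂ) := by fun_prop
  simpa using (h.tendsto 1).mono_left nhdsWithin_le_nhds

theorem eventually_mem_Ioo_zero_one : ∀ᶠ r : ℝ in 𝓝[<] 1, r ∈ Ioo (0 : ℝ) 1 :=
  Ioo_mem_nhdsLT one_pos

/-- Near a regular point of the circle an inner function has an analytic extension, which is
unimodular on the circle and gives the boundary values there. -/
theorem IsInner.exists_extension {f : ℂ → ℂ} (hf : IsInner f) {ξ : Circle}
    (hξ : ξ ∉ singularities f) :
    ∃ g : ℂ → ℂ, ∃ ρ > 0, AnalyticOnNhd ℂ g (Metric.ball (ξ : ℂ) ρ) ∧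
      (∀ z ∈ Metric.ball (ξ : ℂ) ρ, z ∈ disc → g z = f z) ∧
      ∀ η : Circle, (η : ℂ) ∈ Metric.ball (ξ : ℂ) ρ → ‖g η‖ = 1 ∧ HasBoundaryValue f η (g η) := by
  simp only [singularities, mem_ofPred_eq, not_not] at hξ
  obtain ⟨g, hg, hgf⟩ := hξ
  rw [eventually_nhdsWithin_iff] at hgf
  obtain ⟨ρ, hρ, h⟩ := Metric.eventually_nhds_iff_ball.1 (hg.eventually_analyticAt.and hgf)
  have hbv : ∀ η : Circle, (η : ℂ) ∈ Metric.ball (ξ : ℂ) ρ → HasBoundaryValue f η (g η) := by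
    intro η hη
    have h1 := ((h η hη).1.continuousAt.tendsto.comp (tendsto_ofReal_mul_circle η))
    refine h1.congr' ?_
    filter_upwards [tendsto_ofReal_mul_circle η (Metric.isOpen_ball.mem_nhds hη),
      eventually_mem_Ioo_zero_one] with r hr hr1
    exact (h _ hr).2 (ofReal_mul_circle_mem_disc η hr1)
  refine ⟨g, ρ, hρ, fun z hz => (h z hz).1, fun z hz => (h z hz).2, fun η hη => ⟨?_, hbv η hη⟩⟩
  by_contra hne
  have hU : IsOpen {η : Circle | (η : ℂ) ∈ Metric.ball (ξ : ℂ) ρ} :=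
    Metric.isOpen_ball.preimage (by fun_prop)
  have hc : ContinuousOn (fun η : Circle => ‖g η‖) {η : Circle | (η : ℂ) ∈ Metric.ball (ξ : ℂ) ρ} :=
    fun η hη => ((h η hη).1.continuousAt.norm.comp
      (f := fun η : Circle => (η : ℂ)) (by fun_prop)).continuousWithinAt
  -- One point with `‖g‖ ≠ 1` would give a nonempty open set of them, of positive arc length,
  -- against unimodularity almost everywhere.
  have hW := hc.isOpen_inter_preimage hU (isOpen_compl_singleton (x := (1 : ℝ)))
  refine (arcLength_pos hW ⟨η, hη, hne⟩).ne' (measure_mono_null ?_ (ae_iff.1 hf.unimodular))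
  rintro ζ ⟨hζ, hζ1⟩ ⟨w, hw, hwb⟩
  refine hζ1 ?_
  have : NeBot (𝓝[<] (1 : ℝ)) := inferInstance
  have hgw : g ζ = w := tendsto_nhds_unique (hbv ζ hζ) hwb
  simp [hgw, hw]

/-- The radial boundary function of `f` (a junk value where the radial limit does not exist). -/
def boundaryValue (f : ℂ → ℂ) (ξ : Circle) : ℂ :=
  limUnder (𝓝[<] (1 : ℝ)) fun r : ℝ => f ((r : ℂ) * (ξ : ℂ))

theorem HasBoundaryValue.boundaryValue_eq {f : ℂ → ℂ} {ξ : Circle} {w : ℂ}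
    (h : HasBoundaryValue f ξ w) : boundaryValue f ξ = w :=
  Tendsto.limUnder_eq h

theorem IsInner.hasBoundaryValue {f : ℂ → ℂ} (hf : IsInner f) {ξ : Circle}
    (hξ : ξ ∉ singularities f) : HasBoundaryValue f ξ (boundaryValue f ξ) := by
  obtain ⟨g, ρ, hρ, -, -, h⟩ := hf.exists_extension hξ
  have h1 := (h ξ (Metric.mem_ball_self hρ)).2
  rwa [h1.boundaryValue_eq]

theorem IsInner.norm_boundaryValue {f : ℂ → ℂ} (hf : IsInner f) {ξ : Circle}
    (hξ : ξ ∉ singularities f) : ‖boundaryValue f ξ‖ = 1 := by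
  obtain ⟨g, ρ, hρ, -, -, h⟩ := hf.exists_extension hξ
  have h1 := h ξ (Metric.mem_ball_self hρ)
  rw [h1.2.boundaryValue_eq, h1.1]

/-- At a regular point of the circle the phase of an inner function has a derivative `D`, which
is at least half of any lower bound for `(1 - |f|²) / (1 - r)` along the radius. -/
theorem IsInner.exists_phase_deriv {f : ℂ → ℂ} (hf : IsInner f) {θ : ℝ}
    (hθ : Circle.exp θ ∉ singularities f) :
    ∃ D : ℝ, HasDerivAt (fun t : ℝ => boundaryValue f (Circle.exp t))
        (Complex.I * D * boundaryValue f (Circle.exp θ)) θ ∧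
      ∀ (K : ℝ → ℝ) (κ : ℝ), Tendsto K (𝓝[<] 1) (𝓝 κ) →
        (∀ r ∈ Ioo (0 : ℝ) 1, (1 - r) * K r ≤ 1 - ‖f ((r : ℂ) * (Circle.exp θ : ℂ))‖ ^ 2) →
        κ ≤ 2 * D := by
  obtain ⟨g, ρ, hρ, hg, hgf, h⟩ := hf.exists_extension hθ
  set ζ : ℂ := (Circle.exp θ : ℂ) with hζ
  have hmem : ζ ∈ Metric.ball ζ ρ := Metric.mem_ball_self hρ
  have hg1 : ‖g ζ‖ = 1 := (h _ hmem).1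
  have hg0 : g ζ ≠ 0 := norm_ne_zero_iff.1 (by rw [hg1]; exact one_ne_zero)
  have hgd : HasDerivAt g (deriv g ζ) ζ := (hg ζ hmem).differentiableAt.hasDerivAt
  have hexp : HasDerivAt (fun t : ℝ => (Circle.exp t : ℂ)) (ζ * Complex.I) θ := by
    simp only [hζ, Circle.coe_exp]
    simpa using ((Complex.ofRealCLM.hasDerivAt (x := θ)).mul_const Complex.I).cexp
  have hnear : ∀ᶠ t in 𝓝 θ, (Circle.exp t : ℂ) ∈ Metric.ball ζ ρ :=
    hexp.continuousAt.eventually_mem (Metric.isOpen_ball.mem_nhds hmem)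
  -- The logarithmic derivative governs both directions: the tangential derivative of `g` is `i q
  -- g`, the radial one is `q g`.
  set q : ℂ := ζ * deriv g ζ / g ζ with hq
  have hqg : ζ * deriv g ζ = q * g ζ := by rw [hq, div_mul_cancel₀ _ hg0]
  have hu : HasDerivAt (fun t : ℝ => g (Circle.exp t)) (Complex.I * q * g ζ) θ := by
    refine (HasDerivAt.comp θ hgd hexp).congr_deriv ?_
    linear_combination Complex.I * hqg
  have hreim : (g ζ).re ^ 2 + (g ζ).im ^ 2 = 1 := by
    have := Complex.normSq_eq_norm_sq (g ζ)
    rw [hg1, Complex.normSq_apply] at this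
    linarith
  -- `|g|²` is constant along the circle, so its tangential derivative `-2 Im q` vanishes.
  have him : q.im = 0 := by
    have h1 := hu.norm_sq
    have h2 : (fun t : ℝ => ‖g (Circle.exp t)‖ ^ 2) =ᶠ[𝓝 θ] fun _ => 1 := by
      filter_upwards [hnear] with t ht
      rw [(h _ ht).1]; norm_num
    have h3 := h1.unique ((hasDerivAt_const θ (1 : ℝ)).congr_of_eventuallyEq h2)
    rw [← hζ, Complex.inner] at h3
    simp only [Complex.mul_re, Complex.mul_im, Complex.conj_re, Complex.conj_im, Complex.I_re,
      Complex.I_im] at h3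
    linear_combination (-1 / 2 : ℝ) * h3 - q.im * hreim
  have hqre : ((q.re : ℝ) : ℂ) = q := Complex.ext (by simp) (by simp [him])
  have hbv : boundaryValue f (Circle.exp θ) = g ζ := (h _ hmem).2.boundaryValue_eq
  refine ⟨q.re, ?_, fun K κ hK hle => ?_⟩
  · rw [hqre, hbv]
    refine hu.congr_of_eventuallyEq ?_
    filter_upwards [hnear] with t ht
    exact (h _ ht).2.boundaryValue_eq
  · have hr : HasDerivAt (fun r : ℝ => (r : ℂ) * ζ) ζ 1 := by
      simpa using (Complex.ofRealCLM.hasDerivAt (x := 1)).mul_const ζ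
    have hgd' : HasDerivAt g (deriv g ζ) (((1 : ℝ) : ℂ) * ζ) := by simpa using hgd
    have hv := (HasDerivAt.comp (1 : ℝ) hgd' hr).norm_sq
    have hval : 2 * inner ℝ ((g ∘ fun r : ℝ => (r : ℂ) * ζ) 1) (deriv g ζ * ζ) = 2 * q.re := by
      rw [mul_comm (deriv g ζ), hqg, Complex.inner]
      simp only [Function.comp, Complex.ofReal_one, one_mul, Complex.mul_re, Complex.mul_im,
        Complex.conj_re, Complex.conj_im]
      linear_combination 2 * q.re * hreim
    rw [hval] at hv
    have hs := (hasDerivWithinAt_iff_tendsto_slope' (by simp)).1 (hv.hasDerivWithinAt (s := Iio 1))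
    refine le_of_tendsto_of_tendsto hK hs ?_
    filter_upwards [tendsto_ofReal_mul_circle (Circle.exp θ) (Metric.isOpen_ball.mem_nhds hmem),
      eventually_mem_Ioo_zero_one] with r hr1 hr2
    have h1 := hle r hr2
    have h2 : g ((r : ℂ) * ζ) = f ((r : ℂ) * ζ) :=
      hgf _ hr1 (ofReal_mul_circle_mem_disc _ hr2)
    rw [← h2] at h1
    have h3 : (0 : ℝ) < 1 - r := by linarith [hr2.2]
    rw [slope_def_field]
    simp only [Function.comp, Complex.ofReal_one, one_mul, hg1]
    rw [← neg_sub, ← neg_sub (1 : ℝ) r, neg_div_neg_eq, le_div_iff₀ h3]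
    linarith

/-! ### The singular measure near regular points. -/

/-- A measure on the circle that is of quadratic size on the short arcs inside `exp '' [a, b]`
gives no mass to that arc. -/
theorem measureReal_arc_eq_zero (μ : Measure Circle) [IsFiniteMeasure μ] {C a b : ℝ}
    (hab : a ≤ b)
    (hC : ∀ s t : ℝ, a ≤ s → s ≤ t → t ≤ b → μ.real (Circle.exp '' Icc s t) ≤ C * (t - s) ^ 2) :
    μ.real (Circle.exp '' Icc a b) = 0 := by
  have key : ∀ (n : ℕ) (s t : ℝ), a ≤ s → s ≤ t → t ≤ b →
      μ.real (Circle.exp '' Icc s t) ≤ C * (t - s) ^ 2 * (1 / 2) ^ n := by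
    intro n
    induction n with
    | zero => simpa using hC
    | succ n ih =>
      intro s t hs hst ht
      -- Bisection gains a factor `1 / 2` each time: `2 · C (L / 2)² = C L² / 2`.
      have h1 := ih s ((s + t) / 2) hs (by linarith) (by linarith)
      have h2 := ih ((s + t) / 2) t (by linarith) (by linarith) ht
      have h3 : μ.real (Circle.exp '' Icc s t) ≤ μ.real (Circle.exp '' Icc s ((s + t) / 2)) +
          μ.real (Circle.exp '' Icc ((s + t) / 2) t) := by
        rw [← Icc_union_Icc_eq_Icc (b := (s + t) / 2) (by linarith) (by linarith), image_union]
        exact measureReal_union_le _ _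
      refine h3.trans ((add_le_add h1 h2).trans_eq ?_)
      ring
  have hlim : Tendsto (fun n : ℕ => C * (b - a) ^ 2 * (1 / 2 : ℝ) ^ n) atTop (𝓝 0) := by
    simpa using (tendsto_pow_atTop_nhds_zero_of_lt_one (r := (1 / 2 : ℝ)) (by norm_num)
      (by norm_num)).const_mul (C * (b - a) ^ 2)
  exact le_antisymm (ge_of_tendsto' hlim fun n => key n a b le_rfl hab le_rfl) measureReal_nonneg

/-- The measure of a singular inner factor does not charge a neighbourhood of a regular point. -/
theorem IsInner.notMem_support {f S : ℂ → ℂ} {μ : Measure Circle} (hf : IsInner f)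
    (hS : IsSingularInner S μ) (hfS : ∀ z ∈ disc, ‖f z‖ ≤ ‖S z‖) {ξ : Circle}
    (hξ : ξ ∉ singularities f) : ξ ∉ μ.support := by
  have := hS.finite
  obtain ⟨g, ρ, hρ, hg, hgf, h⟩ := hf.exists_extension hξ
  obtain ⟨K, t, ht, hK⟩ := ((hg ξ (Metric.mem_ball_self hρ)).contDiffAt
    (n := 1)).exists_lipschitzOnWith
  obtain ⟨d, hd, hdt⟩ := Metric.mem_nhds_iff.1
    (inter_mem ht (Metric.ball_mem_nhds (ξ : ℂ) hρ))
  obtain ⟨h₀, hh₀, hh₀d, hh₀1, hh₀K⟩ : ∃ h₀ > 0, h₀ < d / 2 ∧ h₀ < 1 ∧ K * h₀ ≤ 1 / 2 := by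
    refine ⟨min (d / 4) (1 / (2 * (K + 1))), by positivity, ?_, ?_, ?_⟩
    · exact (min_le_left _ _).trans_lt (by linarith)
    · refine (min_le_right _ _).trans_lt ?_
      rw [div_lt_one (by positivity)]
      linarith [K.coe_nonneg]
    · calc (K : ℝ) * min (d / 4) (1 / (2 * (K + 1))) ≤ K * (1 / (2 * (K + 1))) := by
            gcongr
            exact min_le_right _ _
        _ ≤ 1 / 2 := by
            rw [mul_one_div, div_le_div_iff₀ (by positivity) two_pos]
            linarith
  have hball : ∀ (η : Circle) (r : ℝ), ‖(η : ℂ) - ξ‖ < d / 2 → 0 < r → r ≤ h₀ →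
      μ.real (Metric.closedBall η r) ≤ 8 * K * r ^ 2 := by
    intro η r hη hr0 hr
    have hz : (((1 - r : ℝ) : ℂ) * η) ∈ disc :=
      ofReal_mul_circle_mem_disc η ⟨by linarith, by linarith⟩
    have hzη : ‖((1 - r : ℝ) : ℂ) * η - η‖ = r := by
      have : ((1 - r : ℝ) : ℂ) * η - η = ((-r : ℝ) : ℂ) * η := by push_cast; ring
      rw [this, norm_mul, Circle.norm_coe, mul_one, Complex.norm_real, norm_neg,
        Real.norm_of_nonneg hr0.le]
    have hzn : ‖((1 - r : ℝ) : ℂ) * η‖ = 1 - r := by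
      rw [norm_mul, Circle.norm_coe, mul_one, Complex.norm_real, Real.norm_of_nonneg (by linarith)]
    set z : ℂ := ((1 - r : ℝ) : ℂ) * η
    have hηd : (η : ℂ) ∈ Metric.ball (ξ : ℂ) d := by
      rw [mem_ball_iff_norm]; linarith
    have hzd : z ∈ Metric.ball (ξ : ℂ) d := by
      rw [mem_ball_iff_norm]
      linarith [norm_sub_le_norm_sub_add_norm_sub z η ξ]
    -- The extension is `K`-Lipschitz and unimodular at `η`, while `z` lies at distance `r` from
    -- `η`.
    have hlow : 1 - K * r ≤ ‖f z‖ := by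
      have h1 := hK.norm_sub_le (hdt hηd).1 (hdt hzd).1
      rw [norm_sub_rev (η : ℂ), hzη] at h1
      have h2 := norm_sub_norm_le (g η) (g z)
      rw [(h η (hdt hηd).2).1, hgf z (hdt hzd).2 hz] at h2
      rw [hgf z (hdt hzd).2 hz] at h1
      linarith
    -- On the ball the Poisson kernel is at least `r (2 - r) / (2 r)² ≥ 1 / (4 r)`.
    have hup : ‖S z‖ ≤ Real.exp (-(1 / (4 * r) * μ.real (Metric.closedBall η r))) := by
      refine hS.norm_le_exp hz Metric.isClosed_closedBall.measurableSet fun ζ hζ => ?_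
      have hζη : ‖(ζ : ℂ) - η‖ ≤ r := by
        rw [Metric.mem_closedBall, circle_dist_eq] at hζ
        exact hζ
      have h1 : ‖(ζ : ℂ) - z‖ ≤ 2 * r := by
        have := norm_sub_le_norm_sub_add_norm_sub (ζ : ℂ) η z
        rw [norm_sub_rev (η : ℂ) z, hzη] at this
        linarith
      have h2 : 0 < ‖(ζ : ℂ) - z‖ := norm_pos_iff.2 (circle_sub_ne_zero ζ hz)
      rw [herglotz_re, hzn, div_le_div_iff₀ (by positivity) (by positivity)]
      have h3 : ‖(ζ : ℂ) - z‖ ^ 2 ≤ (2 * r) ^ 2 := by gcongr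
      have h4 : 0 ≤ r ^ 2 * (1 - r) := mul_nonneg (sq_nonneg r) (by linarith)
      nlinarith
    set m := μ.real (Metric.closedBall η r)
    have hP : 0 ≤ 1 / (4 * r) * m := mul_nonneg (by positivity) measureReal_nonneg
    have h1 : 1 - K * r ≤ Real.exp (-(1 / (4 * r) * m)) := hlow.trans ((hfS z hz).trans hup)
    have h2 : (1 - K * r) * (1 + 1 / (4 * r) * m) ≤ 1 := by
      rw [Real.exp_neg] at h1
      have h3 := Real.add_one_le_exp (1 / (4 * r) * m)
      calc (1 - K * r) * (1 + 1 / (4 * r) * m)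
          ≤ (Real.exp (1 / (4 * r) * m))⁻¹ * Real.exp (1 / (4 * r) * m) := by
            gcongr
            linarith
        _ = 1 := inv_mul_cancel₀ (Real.exp_pos _).ne'
    have hKr : (K : ℝ) * r ≤ 1 / 2 := (mul_le_mul_of_nonneg_left hr K.coe_nonneg).trans hh₀K
    have h4 : 1 / (4 * r) * m ≤ 2 * K * r := by nlinarith
    have h5 : m = 1 / (4 * r) * m * (4 * r) := by field_simp
    rw [h5]
    nlinarith
  obtain ⟨θ, rfl⟩ := Circle.exp_surjective ξ
  have harc : μ.real (Circle.exp '' Icc (θ - h₀ / 2) (θ + h₀ / 2)) = 0 := by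
    refine measureReal_arc_eq_zero μ (C := 8 * K) (by linarith) fun s t hs hst ht => ?_
    -- A degenerate arc lies in balls of every positive radius, so its mass is at most the limit of
    -- their bounds.
    rcases hst.eq_or_lt with rfl | hst'
    · have hlim : Tendsto (fun r : ℝ => 8 * (K : ℝ) * r ^ 2) (𝓝[>] 0) (𝓝 0) := by
        have hc : Continuous fun r : ℝ => 8 * (K : ℝ) * r ^ 2 := by fun_prop
        simpa using (hc.tendsto 0).mono_left nhdsWithin_le_nhds
      rw [sub_self, zero_pow two_ne_zero, mul_zero]
      refine ge_of_tendsto hlim ?_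
      filter_upwards [Ioc_mem_nhdsGT hh₀] with r hr
      refine (measureReal_mono ?_).trans (hball (Circle.exp s) r ?_ hr.1 hr.2)
      · simpa using hr.1.le
      · refine (norm_circle_exp_sub_le _ _).trans_lt ?_
        rw [abs_lt]; constructor <;> linarith
    · refine (measureReal_mono ?_).trans (hball (Circle.exp s) (t - s) ?_ (by linarith)
        (by linarith))
      · rintro _ ⟨x, hx, rfl⟩
        rw [Metric.mem_closedBall, circle_dist_eq]
        refine (norm_circle_exp_sub_le _ _).trans ?_
        rw [abs_of_nonneg (by linarith [hx.1])]
        linarith [hx.2]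
      · refine (norm_circle_exp_sub_le _ _).trans_lt ?_
        rw [abs_lt]; constructor <;> linarith
  refine Measure.notMem_support_iff_exists.2 ⟨_, ?_, (measureReal_eq_zero_iff).1 harc⟩
  exact isLocalHomeomorph_circleExp.isOpenMap.image_mem_nhds
    (Icc_mem_nhds (by linarith) (by linarith))

/-- A point of the support of the measure of a singular inner factor is an atom, provided that
there are only finitely many singularities. -/
theorem IsInner.measureReal_singleton_pos {f S : ℂ → ℂ} {μ : Measure Circle} (hf : IsInner f)
    (hS : IsSingularInner S μ) (hfS : ∀ z ∈ disc, ‖f z‖ ≤ ‖S z‖)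
    (hfin : (singularities f).Finite) {ξ : Circle} (hξ : ξ ∈ μ.support) : 0 < μ.real {ξ} := by
  have := hS.finite
  have hV : (singularities f \ {ξ})ᶜ ∈ 𝓝 ξ :=
    (hfin.subset sdiff_subset).isClosed.isOpen_compl.mem_nhds (by simp)
  have h1 := (Measure.mem_support_iff_forall ξ).1 hξ _ hV
  have h2 : (singularities f \ {ξ})ᶜ ⊆ {ξ} ∪ μ.supportᶜ := by
    intro η hη
    by_cases hηξ : η = ξ
    · exact Or.inl hηξ
    · exact Or.inr (hf.notMem_support hS hfS fun hs => hη ⟨hs, hηξ⟩)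
  have h3 := h1.trans_le ((measure_mono h2).trans (measure_union_le _ _))
  rw [Measure.measure_compl_support, add_zero] at h3
  exact ENNReal.toReal_pos h3.ne' (measure_ne_top _ _)

/-! ### From a steep phase to infinitely many solutions. -/

/-- A differentiable unimodular function whose phase is monotone, with derivative of order at
least `c / h` on `[h / 2, h]` for arbitrarily small `h`, takes the value `1` arbitrarily close to
`0`. -/
theorem exists_eq_one_of_phase_deriv {u : ℝ → ℂ} {D : ℝ → ℝ} {s c δ : ℝ} (hs : s ^ 2 = 1)
    (hc : 0 < c) (hδ : 0 < δ) (hu : ∀ t ∈ Ioo 0 δ, ‖u t‖ = 1)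
    (hd : ∀ t ∈ Ioo 0 δ, HasDerivAt u (s * (Complex.I * D t * u t)) t)
    (hD : ∀ t ∈ Ioo 0 δ, 0 ≤ D t)
    (hDc : ∃ᶠ h in 𝓝[>] (0 : ℝ), ∀ t ∈ Icc (h / 2) h, c / h ≤ D t) :
    ∃ t ∈ Ioo 0 δ, u t = 1 := by
  by_contra! hne
  have hsq : ∀ t ∈ Ioo 0 δ, (u t).re ^ 2 + (u t).im ^ 2 = 1 := fun t ht => by
    have h1 := Complex.normSq_eq_norm_sq (u t)
    rw [hu t ht, Complex.normSq_apply] at h1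
    linarith
  have hre : ∀ t ∈ Ioo 0 δ, 1 - (u t).re ≠ 0 := fun t ht h0 => by
    have h1 : (u t).re = 1 := by linarith
    have h2 := hsq t ht
    rw [h1] at h2
    exact hne t ht (Complex.ext h1 (by simpa using h2))
  -- For `u = e^{iψ}` the quotient is `-cot (ψ / 2) = tan (ψ / 2 - π / 2)`. So while `u ≠ 1`, `v` is
  -- up to sign a branch of half the phase, confined to `(-π/2, π/2)`.
  set v : ℝ → ℝ := fun t => s * Real.arctan (-(u t).im / (1 - (u t).re)) with hv
  have hvd : ∀ t ∈ Ioo 0 δ, HasDerivAt v (D t / 2) t := by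
    intro t ht
    have hR : HasDerivAt (fun t => (u t).re) (-(s * D t * (u t).im)) t := by
      have := (Complex.reCLM.hasFDerivAt.comp_hasDerivAt t (hd t ht))
      refine this.congr_deriv ?_
      simp [mul_assoc]
    have hI : HasDerivAt (fun t => (u t).im) (s * D t * (u t).re) t := by
      have := (Complex.imCLM.hasFDerivAt.comp_hasDerivAt t (hd t ht))
      refine this.congr_deriv ?_
      simp [mul_assoc]
    have h0 := hre t ht
    have h1 := hsq t ht
    refine (((hI.neg.div (hR.const_sub 1) h0).arctan).const_mul s).congr_deriv ?_
    have h2 : 1 + (-(u t).im / (1 - (u t).re)) ^ 2 = 2 / (1 - (u t).re) := by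
      field_simp
      linear_combination h1
    simp only [Pi.neg_apply, Pi.div_apply]
    rw [h2]
    field_simp
    linear_combination (D t * (1 - (u t).re)) * hs + s ^ 2 * D t * h1
  have hmono : MonotoneOn v (Ioo 0 δ) := by
    refine monotoneOn_of_deriv_nonneg (convex_Ioo 0 δ)
      (fun t ht => (hvd t ht).continuousAt.continuousWithinAt) ?_ ?_ <;>
      rw [interior_Ioo] <;> intro t ht
    · exact (hvd t ht).differentiableAt.differentiableWithinAt
    · rw [(hvd t ht).deriv]
      linarith [hD t ht]
  have hsabs : |s| = 1 := by
    rw [← sq_abs] at hs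
    nlinarith [abs_nonneg s]
  have hbdd : BddBelow (v '' Ioo 0 δ) := by
    refine ⟨-(Real.pi / 2), ?_⟩
    rintro _ ⟨t, -, rfl⟩
    have h1 : |v t| ≤ Real.pi / 2 := by
      rw [hv, abs_mul, hsabs, one_mul]
      exact (abs_lt.2 ⟨Real.neg_pi_div_two_lt_arctan _, Real.arctan_lt_pi_div_two _⟩).le
    exact (abs_le.1 h1).1
  have hlim := hmono.tendsto_nhdsWithin_Ioo_right ⟨δ / 2, by linarith, by linarith⟩ hbdd
  have hhalf : Tendsto (fun h : ℝ => h / 2) (𝓝[>] 0) (𝓝[>] 0) := by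
    refine tendsto_nhdsWithin_iff.2 ⟨?_, ?_⟩
    · have hc : Continuous fun h : ℝ => h / 2 := by fun_prop
      simpa using (hc.tendsto 0).mono_left nhdsWithin_le_nhds
    · filter_upwards [self_mem_nhdsWithin] with h hh
      exact half_pos (mem_Ioi.1 hh)
  -- Monotone and bounded below, `v` converges at `0⁺`, so `v h - v (h / 2)` tends to `0`; steepness
  -- keeps it at least `c / 4` for arbitrarily small `h`.
  have hdiff := hlim.sub (hlim.comp hhalf)
  rw [sub_self] at hdiff
  have hsmall := hdiff.eventually_lt_const (show 0 < c / 4 by positivity)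
  obtain ⟨h, hh, hlt, hh0, hhδ⟩ := (hDc.and_eventually (hsmall.and (Ioo_mem_nhdsGT hδ))).exists
  have hin : ∀ t ∈ Icc (h / 2) h, t ∈ Ioo 0 δ := fun t ht =>
    ⟨by linarith [ht.1], by linarith [ht.2]⟩
  obtain ⟨t, ht, hslope⟩ := exists_hasDerivAt_eq_slope v (fun t => D t / 2)
    (show h / 2 < h by linarith)
    (fun t ht => (hvd t (hin t ht)).continuousAt.continuousWithinAt)
    (fun t ht => hvd t (hin t (Ioo_subset_Icc_self ht)))
  have h1 := hh t (Ioo_subset_Icc_self ht)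
  have h2 : c / h / 2 ≤ (v h - v (h / 2)) / (h - h / 2) := by
    rw [← hslope]; linarith
  rw [le_div_iff₀ (by linarith)] at h2
  have h3 : c / h / 2 * (h - h / 2) = c / 4 := by field_simp; ring
  simp only [Function.comp] at hlt
  linarith

theorem circle_exp_ne {θ φ : ℝ} (h0 : φ ≠ θ) (h1 : |φ - θ| ≤ 1) :
    Circle.exp φ ≠ Circle.exp θ := by
  rw [abs_le] at h1
  intro h
  exact h0 (Circle.exp_injOn_Icc (a := θ - 1) (b := θ + 1) (by linarith [Real.pi_gt_three])
    ⟨by linarith, by linarith⟩ ⟨by linarith, by linarith⟩ h)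

theorem eventually_circle_exp_notMem {F : Set Circle} (hF : F.Finite)
    (θ : ℝ) {s : ℝ} (hs : |s| = 1) : ∀ᶠ t in 𝓝[>] (0 : ℝ), Circle.exp (θ + s * t) ∉ F := by
  have hV : (F \ {Circle.exp θ})ᶜ ∈ 𝓝 (Circle.exp θ) :=
    (hF.subset sdiff_subset).isClosed.isOpen_compl.mem_nhds (by simp)
  have hc : Continuous fun t : ℝ => Circle.exp (θ + s * t) := by fun_prop
  have hlim : Tendsto (fun t : ℝ => Circle.exp (θ + s * t)) (𝓝[>] 0) (𝓝 (Circle.exp θ)) := by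
    simpa using (hc.tendsto 0).mono_left nhdsWithin_le_nhds
  filter_upwards [hlim hV, Ioo_mem_nhdsGT one_pos] with t ht ht1 htF
  refine ht ⟨htF, circle_exp_ne ?_ ?_⟩
  · have : s ≠ 0 := by
      rintro rfl
      simp at hs
    simpa using ⟨this, ht1.1.ne'⟩
  · rw [add_sub_cancel_left, abs_mul, hs, one_mul, abs_of_pos ht1.1]
    exact ht1.2.le

/-- Near `exp (i θ)` the phase derivative of `f` is, for arbitrarily small `h`, of order at least
`1 / h` at the points at distance between `h / 2` and `h`. It is expressed by lower bounds for
`(1 - |f|²) / (1 - r)` along the radii. -/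
def HasSteepPhase (f : ℂ → ℂ) (θ : ℝ) : Prop :=
  ∃ c > 0, ∃ᶠ h in 𝓝[>] (0 : ℝ), ∀ φ : ℝ, |φ - θ| ∈ Icc (h / 2) h →
    ∃ (K : ℝ → ℝ) (κ : ℝ), 2 * (c / h) ≤ κ ∧ Tendsto K (𝓝[<] 1) (𝓝 κ) ∧
      ∀ r ∈ Ioo (0 : ℝ) 1, (1 - r) * K r ≤ 1 - ‖f ((r : ℂ) * (Circle.exp φ : ℂ))‖ ^ 2

/-- If the solutions were finite in number, a short interval `(0, δ)` would avoid them and all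
singularities, yet it must contain a solution. The sign `s` selects the side of `θ`. -/
theorem IsInner.infinite_solutions {f : ℂ → ℂ} (hf : IsInner f)
    (hfin : (singularities f).Finite) (hb : ∀ z ∈ disc, ‖f z‖ ≤ 1) {θ : ℝ}
    (hsteep : HasSteepPhase f θ) {s ε : ℝ} (hs : |s| = 1) (hε : 0 < ε) {A : Set ℝ}
    (hA : ∀ t ∈ Ioo 0 ε, θ + s * t ∈ A) :
    {ξ : Circle | ξ ∈ Circle.exp '' A ∧ HasBoundaryValue f ξ 1}.Infinite := by
  intro hF
  obtain ⟨δ, hδ, hδ'⟩ := mem_nhdsGT_iff_exists_Ioo_subset.1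
    ((eventually_circle_exp_notMem (hF.union hfin) θ hs).and (Ioo_mem_nhdsGT hε))
  have hreg : ∀ t ∈ Ioo 0 δ, Circle.exp (θ + s * t) ∉ singularities f := fun t ht hsing =>
    (hδ' ht).1 (Or.inr hsing)
  have hphase := fun t ht => hf.exists_phase_deriv (hreg t ht)
  choose! D hD hDle using hphase
  obtain ⟨c, hc, hfreq⟩ := hsteep
  obtain ⟨t, ht, hut⟩ := exists_eq_one_of_phase_deriv
    (u := fun t => boundaryValue f (Circle.exp (θ + s * t))) (D := D) (s := s) (c := c) (δ := δ)
    (by rw [← sq_abs, hs, one_pow]) hc hδ (fun t ht => hf.norm_boundaryValue (hreg t ht))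
    (fun t ht => by
      have h1 : HasDerivAt (fun t : ℝ => θ + s * t) s t := by
        simpa using ((hasDerivAt_id t).const_mul s).const_add θ
      simpa [Function.comp_def] using (hD t ht).scomp t h1)
    -- The trivial lower bound `K = 0`, valid as `‖f‖ ≤ 1`, makes the phase monotone.
    (fun t ht => by
      have h1 := hDle t ht (fun _ => 0) 0 tendsto_const_nhds fun r hr => by
        have h2 := hb _ (ofReal_mul_circle_mem_disc (Circle.exp (θ + s * t)) hr)
        nlinarith [norm_nonneg (f (r * (Circle.exp (θ + s * t) : ℂ)))]
      linarith)
    (by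
      refine (hfreq.and_eventually (Ioo_mem_nhdsGT hδ)).mono fun h hh t ht => ?_
      have htpos : 0 < t := by linarith [ht.1, hh.2.1]
      obtain ⟨K, κ, hκ, hK, hKle⟩ := hh.1 (θ + s * t) (by
        rwa [add_sub_cancel_left, abs_mul, hs, one_mul, abs_of_pos htpos])
      have h1 := hDle t ⟨htpos, ht.2.trans_lt hh.2.2⟩ K κ hK hKle
      linarith)
  have h1 := hf.hasBoundaryValue (hreg t ht)
  rw [hut] at h1
  exact (hδ' ht).1 (Or.inl ⟨mem_image_of_mem _ (hA t (hδ' ht).2), h1⟩)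

theorem IsInner.isTypeTwo {f : ℂ → ℂ} (hf : IsInner f) (hfin : (singularities f).Finite)
    (hb : ∀ z ∈ disc, ‖f z‖ ≤ 1) {θ : ℝ} (hsteep : HasSteepPhase f θ)
    (hsing : Circle.exp θ ∈ singularities f) : IsTypeTwo f θ :=
  ⟨hsing, fun _ hε =>
    ⟨hf.infinite_solutions hfin hb hsteep (s := -1) (by simp) hε fun t ht =>
        ⟨by linarith [ht.2], by linarith [ht.1]⟩,
      hf.infinite_solutions hfin hb hsteep (s := 1) (by simp) hε fun t ht =>
        ⟨by linarith [ht.1], by linarith [ht.2]⟩⟩⟩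

/-! ### Zeros in a Stolz angle and atoms as sources of steep phase. -/

/-- A limit of zeros is a singularity. -/
theorem IsInner.mem_singularities_of_tendsto_zeros {f : ℂ → ℂ} (hf : IsInner f) {ξ : Circle}
    {z : ℕ → ℂ} (hz : ∀ n, z n ∈ disc ∧ f (z n) = 0) (hlim : Tendsto z atTop (𝓝 (ξ : ℂ))) :
    ξ ∈ singularities f := by
  by_contra hξ
  obtain ⟨g, ρ, hρ, hg, hgf, h⟩ := hf.exists_extension hξ
  have hmem := Metric.mem_ball_self (x := (ξ : ℂ)) hρ
  have h1 : Tendsto (fun n => g (z n)) atTop (𝓝 (g ξ)) :=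
    (hg ξ hmem).continuousAt.tendsto.comp hlim
  have h2 : (fun n => g (z n)) =ᶠ[atTop] fun _ => 0 := by
    filter_upwards [hlim (Metric.isOpen_ball.mem_nhds hmem)] with n hn
    rw [hgf _ hn (hz n).1, (hz n).2]
  have h3 : g ξ = 0 := tendsto_nhds_unique (h1.congr' h2) tendsto_const_nhds
  have h4 := (h ξ hmem).1
  simp [h3] at h4

theorem hasSteepPhase_of_zeros {f : ℂ → ℂ} (hd : DifferentiableOn ℂ f disc)
    (hb : ∀ z ∈ disc, ‖f z‖ ≤ 1) {θ α : ℝ} (hα : 0 < α) {z : ℕ → ℂ}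
    (hz : ∀ n, z n ∈ stolzAngle (Circle.exp θ) α ∧ f (z n) = 0)
    (hlim : Tendsto z atTop (𝓝 (Circle.exp θ : ℂ))) : HasSteepPhase f θ := by
  refine ⟨1 / (1 + α) ^ 2, by positivity, ?_⟩
  have hh : Tendsto (fun n => 1 - ‖z n‖) atTop (𝓝[>] 0) := by
    refine tendsto_nhdsWithin_iff.2 ⟨?_, Eventually.of_forall fun n => ?_⟩
    · simpa using hlim.norm.const_sub 1
    · exact sub_pos.2 (mem_disc.1 (hz n).1.1)
  refine hh.frequently (Frequently.of_forall fun n φ hφ => ?_)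
  obtain ⟨⟨ha, hst⟩, hfa⟩ := hz n
  set a := z n
  set h := 1 - ‖a‖ with hdef
  have ha1 := mem_disc.1 ha
  have hpos : 0 < h := sub_pos.2 ha1
  set ζ : ℂ := (Circle.exp φ : ℂ) with hζ
  have hζ1 : ‖ζ‖ = 1 := Circle.norm_coe _
  have hne : ‖1 - (starRingEnd ℂ) a * ζ‖ ≠ 0 :=
    norm_ne_zero_iff.2 (one_sub_conj_mul_ne_zero ha1 hζ1.le)
  -- On the circle `|1 - āζ| = |a - ζ|`; the path through `e^{iθ}` costs at most `h` for the arc and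
  -- `αh` for the Stolz angle.
  have hle : ‖1 - (starRingEnd ℂ) a * ζ‖ ^ 2 ≤ ((1 + α) * h) ^ 2 := by
    have h1 := norm_sq_one_sub_conj_mul_sub a ζ
    rw [hζ1, one_pow, sub_self, mul_zero, sub_eq_zero] at h1
    rw [h1, norm_sub_rev]
    have h2 := norm_circle_exp_sub_le φ θ
    have h3 := norm_sub_le_norm_sub_add_norm_sub ζ (Circle.exp θ) a
    gcongr
    linarith [hφ.2]
  -- `K` is the Schwarz-Pick bound for `1 - |f|²`, divided by `1 - r`.
  refine ⟨fun r => (1 - ‖a‖ ^ 2) * (1 + r) / ‖1 - (starRingEnd ℂ) a * (r * ζ)‖ ^ 2,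
    (1 - ‖a‖ ^ 2) * (1 + 1) / ‖1 - (starRingEnd ℂ) a * ((1 : ℝ) * ζ)‖ ^ 2, ?_, ?_, fun r hr => ?_⟩
  · rw [Complex.ofReal_one, one_mul]
    calc 2 * (1 / (1 + α) ^ 2 / h) = h * (1 + 1) / ((1 + α) * h) ^ 2 := by field_simp; ring
      _ ≤ (1 - ‖a‖ ^ 2) * (1 + 1) / ‖1 - (starRingEnd ℂ) a * ζ‖ ^ 2 := by
        have h1 : h ≤ 1 - ‖a‖ ^ 2 := by nlinarith [norm_nonneg a]
        have h2 : 0 < ‖1 - (starRingEnd ℂ) a * ζ‖ := norm_pos_iff.2 (norm_ne_zero_iff.1 hne)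
        have h3 : 0 ≤ 1 - ‖a‖ ^ 2 := hpos.le.trans h1
        gcongr
  · refine Tendsto.mono_left (ContinuousAt.tendsto ?_) nhdsWithin_le_nhds
    refine ContinuousAt.div (by fun_prop) (by fun_prop) ?_
    rw [Complex.ofReal_one, one_mul]
    exact pow_ne_zero 2 hne
  · have hrd := ofReal_mul_circle_mem_disc (Circle.exp φ) hr
    have hrn : ‖(r : ℂ) * ζ‖ = r := by
      rw [norm_mul, hζ1, mul_one, Complex.norm_real, Real.norm_of_nonneg hr.1.le]
    have h1 := norm_le_norm_mobius hd hb ha hfa hrd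
    have h2 := one_sub_norm_mobius_sq ha1 (mem_disc.1 hrd).le
    rw [← hζ] at h1 h2
    rw [hrn] at h2
    have h3 : ‖f (r * ζ)‖ ^ 2 ≤ ‖mobius a (r * ζ)‖ ^ 2 := by gcongr
    have h4 : (1 - r) * ((1 - ‖a‖ ^ 2) * (1 + r) / ‖1 - (starRingEnd ℂ) a * (r * ζ)‖ ^ 2)
        = (1 - ‖a‖ ^ 2) * (1 - r ^ 2) / ‖1 - (starRingEnd ℂ) a * (r * ζ)‖ ^ 2 := by ring
    rw [h4, ← h2]
    linarith

theorem IsSingularInner.hasSteepPhase_of_atom {f S : ℂ → ℂ} {μ : Measure Circle}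
    (hS : IsSingularInner S μ) (hfS : ∀ z ∈ disc, ‖f z‖ ≤ ‖S z‖) {θ : ℝ}
    (hm : 0 < μ.real {Circle.exp θ}) : HasSteepPhase f θ := by
  set m := μ.real {Circle.exp θ} with hmdef
  set ξ : ℂ := (Circle.exp θ : ℂ) with hξ
  refine ⟨2 * m, by positivity, Eventually.frequently ?_⟩
  filter_upwards [Ioo_mem_nhdsGT one_pos] with h hh φ hφ
  set ζ : ℂ := (Circle.exp φ : ℂ) with hζ
  have hne : ξ - ζ ≠ 0 := by
    intro h0
    refine circle_exp_ne (θ := θ) (φ := φ) ?_ (hφ.2.trans hh.2.le) 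
      (Circle.ext (sub_eq_zero.1 h0).symm)
    rintro rfl
    have := hφ.1
    rw [sub_self, abs_zero] at this
    linarith [hh.1]
  have hpos : 0 < ‖ξ - ζ‖ := norm_pos_iff.2 hne
  have hle : ‖ξ - ζ‖ ≤ h := by
    rw [norm_sub_rev]
    exact (norm_circle_exp_sub_le φ θ).trans hφ.2
  -- With `x` equal to `m` times the Poisson kernel, `|f|² ≤ e^{-2x} ≤ 1 / (1 + 2x)`, and `K` is `(1
  -- - 1 / (1 + 2x)) / (1 - r)` cleared of fractions. Its limit is `4m / |ξ - ζ|²`, of order `1 /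
  -- h²`, more than is needed.
  refine ⟨fun r => 2 * m * (1 + r) / (‖ξ - r * ζ‖ ^ 2 + 2 * m * (1 - r ^ 2)),
    2 * m * (1 + 1) / (‖ξ - (1 : ℝ) * ζ‖ ^ 2 + 2 * m * (1 - 1 ^ 2)), ?_, ?_, fun r hr => ?_⟩
  · rw [Complex.ofReal_one, one_mul, one_pow, sub_self, mul_zero, add_zero]
    have h1 : ‖ξ - ζ‖ ^ 2 ≤ h := by nlinarith [hh.1, hh.2]
    calc 2 * (2 * m / h) = 2 * m * (1 + 1) / h := by ring
      _ ≤ _ := by gcongr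
  · refine Tendsto.mono_left (ContinuousAt.tendsto ?_) nhdsWithin_le_nhds
    refine ContinuousAt.div (by fun_prop) (by fun_prop) ?_
    rw [Complex.ofReal_one, one_mul, one_pow, sub_self, mul_zero, add_zero]
    positivity
  · have hrd := ofReal_mul_circle_mem_disc (Circle.exp φ) hr
    have hrn : ‖(r : ℂ) * ζ‖ = r := by
      rw [norm_mul, Circle.norm_coe, mul_one, Complex.norm_real, Real.norm_of_nonneg hr.1.le]
    set z : ℂ := (r : ℂ) * ζ with hz
    have hd : 0 < ‖ξ - z‖ := norm_pos_iff.2 (circle_sub_ne_zero (Circle.exp θ) hrd)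
    have h1 := hS.norm_le_exp hrd (measurableSet_singleton (Circle.exp θ))
      (c := (1 - r ^ 2) / ‖ξ - z‖ ^ 2) (fun ζ' hζ' => by
        rw [mem_singleton_iff.1 hζ', herglotz_re, hrn])
    rw [← hmdef] at h1
    set x := (1 - r ^ 2) / ‖ξ - z‖ ^ 2 * m with hx
    have hr2 : 0 < 1 - r ^ 2 := by nlinarith [hr.1, hr.2]
    have hx0 : 0 < x := by positivity
    have h2 : ‖f z‖ ^ 2 ≤ Real.exp (-(2 * x)) := by
      calc ‖f z‖ ^ 2 ≤ Real.exp (-x) ^ 2 := by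
            gcongr
            exact (hfS z hrd).trans h1
        _ = Real.exp (-(2 * x)) := by
            rw [← Real.exp_nat_mul]
            congr 1
            push_cast
            ring
    have h3 : Real.exp (-(2 * x)) ≤ 1 / (1 + 2 * x) := by
      rw [Real.exp_neg, ← one_div]
      exact one_div_le_one_div_of_le (by positivity) (by linarith [Real.add_one_le_exp (2 * x)])
    have h4 : (1 - r) * (2 * m * (1 + r) / (‖ξ - z‖ ^ 2 + 2 * m * (1 - r ^ 2)))
        = 1 - 1 / (1 + 2 * x) := by
      have h5 : x * ‖ξ - z‖ ^ 2 = (1 - r ^ 2) * m := by rw [hx]; field_simp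
      rw [eq_sub_iff_add_eq, ← mul_div_assoc, div_add_div _ _ (by positivity) (by positivity),
        div_eq_one_iff_eq (by positivity)]
      linear_combination -2 * h5
    rw [h4]
    linarith

end InnerFunction
end

theorem mainTheorem7 (Θ B S : ℂ → ℂ) (μ : MeasureTheory.Measure Circle)
    (hΘ : InnerFunction.IsInner Θ)
    (hB : InnerFunction.IsBlaschkeProduct B)
    (hS : InnerFunction.IsSingularInner S μ)
    (hBS : ∀ z ∈ InnerFunction.disc, Θ z = B z * S z)
    (hfin : (InnerFunction.singularities Θ).Finite)
    (θ₀ : ℝ)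
    (h : (∃ α : ℝ, 1 < α ∧ ∃ z : ℕ → ℂ,
            (∀ n, z n ∈ InnerFunction.stolzAngle (Circle.exp θ₀) α ∧ Θ (z n) = 0) ∧
            Filter.Tendsto z Filter.atTop (nhds (Circle.exp θ₀ : ℂ))) ∨
         Circle.exp θ₀ ∈ μ.support) :
    InnerFunction.IsTypeTwo Θ θ₀ := by
  have hΘS : ∀ z ∈ InnerFunction.disc, ‖Θ z‖ ≤ ‖S z‖ := fun z hz => by
    rw [hBS z hz, norm_mul]
    exact mul_le_of_le_one_left (norm_nonneg _) (hB.norm_le_one hz)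
  have hb : ∀ z ∈ InnerFunction.disc, ‖Θ z‖ ≤ 1 := fun z hz =>
    (hΘS z hz).trans (hS.norm_le_one hz)
  rcases h with ⟨α, hα, z, hz, hlim⟩ | hsupp
  · exact hΘ.isTypeTwo hfin hb
      (InnerFunction.hasSteepPhase_of_zeros hΘ.analytic.differentiableOn hb
        (zero_lt_one.trans hα) hz hlim)
      (hΘ.mem_singularities_of_tendsto_zeros (fun n => ⟨(hz n).1.1, (hz n).2⟩) hlim)
  · refine hΘ.isTypeTwo hfin hb
      (hS.hasSteepPhase_of_atom hΘS (hΘ.measureReal_singleton_pos hS hΘS hfin hsupp)) ?_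
    by_contra hns
    exact hΘ.notMem_support hS hΘS hns hsupp
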